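/- A metric graph is a finite connected multigraph (loops and multiple edges allowed) with positive edge lengths, and its genus is its first Betti number. Let $M_4$ be the moduli space of metric graphs of genus $4$: its points are isomorphism classes of connected metric graphs of genus $4$ all of whose vertices have valence at least $3$, and a subset is open if and only if, for every such combinatorial graph $G$, its preimage is open in the cone of functions $\ell \colon E(G) \to \mathbb{R}_{\ge 0}$ whose zero set contains no cycle, where edges of length zero are contracted. For a metric graph $\Gamma$, let $W^1_3(\Gamma) \subset \mathrm{Pic}_3(\Gamma)$ be the set of classes of divisors of degree $3$ and Baker–Norine rank at least $1$; it is a polyhedral subset of the real torus torsor $\mathrm{Pic}_3(\Gamma)$, i.e. the image of a finite union of polytopes in the universal cover, and its dimension is the maximal dimension of a cell. A loop of loops of genus $4$ is a metric graph with six vertices $v_1,w_1,v_2,w_2,v_3,w_3$, one edge of length $\ell_i$ joining $v_i$ to $w_i$, and two edges (of arbitrary positive lengths) joining $w_i$ to $v_{i+1}$, for $i=1,2,3$, with indices modulo $3$. **Theorem.** Let $U \subset M_4$ be the set of classes of loops of loops of genus $4$ that satisfy $\ell_1 > \ell_2 > \ell_3$ and $\ell_2 + \ell_3 > \ell_1$.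 Then $U$ is nonempty and open in $M_4$, every graph in $U$ is without separating edges, and so $U$ is also open in the moduli space of metric graphs of genus $4$ without separating edges (a subspace of $M_4$). For every $\Gamma$ in $U$, $$\dim W^1_3(\Gamma) > 0 = \rho(4,1,3), \qquad \text{where } \rho(g,r,d) = g-(r+1)(g-d+r).$$ -/

import Mathlib

open scoped Topology

namespace TropicalBN

noncomputable section

/-- A finite multigraph. Loops and multiple edges are allowed. Each edge carries an auxiliary
orientation from `src` to `tgt`, which isomorphisms are free to reverse. -/
structure Multigraph where
  V : Type
  E : Type
  fintypeV : Fintype V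
  fintypeE : Fintype E
  src : E → V
  tgt : E → V

attribute [instance] Multigraph.fintypeV Multigraph.fintypeE

namespace Multigraph

variable (G : Multigraph)

/-- The connected components of the subgraph with all vertices of `G` and with edge set `I`. -/
abbrev Components (I : Set G.E) : Type :=
  Quot fun u v : G.V => ∃ e ∈ I, G.src e = u ∧ G.tgt e = v

/-- The first Betti number of the subgraph with edge set `I`. -/
def betti (I : Set G.E) : ℤ :=
  (Nat.card I : ℤ) - (Nat.card G.V : ℤ) + (Nat.card (G.Components I) : ℤ)

/-- The genus, i.e. the first Betti number of the graph. -/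
def genus : ℤ := G.betti Set.univ

def IsConnected : Prop := Nat.card (G.Components Set.univ) = 1

/-- The valence of a vertex; a loop counts twice. -/
def valence (v : G.V) : ℕ :=
  Nat.card {e : G.E // G.src e = v} + Nat.card {e : G.E // G.tgt e = v}

/-- The edge `e` is separating if the graph without `e` is not connected. -/
def IsSeparating (e : G.E) : Prop := Nat.card (G.Components {e}ᶜ) ≠ 1

/-- A combinatorial type of metric graphs of genus `g`: a connected graph of genus `g` all of
whose vertices have valence at least three. -/
structure IsStable (g : ℕ) : Prop where
  connected : G.IsConnected
  genus_eq : G.genus = g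
  three_le_valence : ∀ v, 3 ≤ G.valence v

/-- The cone of possibly degenerate length functions on `G` for which the genus does not drop:
lengths are nonnegative, and the edges of length zero, which get contracted, form a forest. -/
def lengthCone : Set (G.E → ℝ) :=
  {ℓ | (∀ e, 0 ≤ ℓ e) ∧ G.betti {e | ℓ e = 0} = 0}

end Multigraph

/-- A metric graph, given by a finite multigraph with positive edge lengths. -/
structure MetricGraph extends Multigraph where
  len : E → ℝ
  len_pos : ∀ e, 0 < len e

namespace MetricGraph

/-- An isomorphism of metric graphs: bijections of vertices and of edges that preserve lengths
and endpoints, where edges may be reversed. -/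
structure Iso (Γ Γ' : MetricGraph) where
  vert : Γ.V ≃ Γ'.V
  edge : Γ.E ≃ Γ'.E
  len_eq : ∀ e, Γ'.len (edge e) = Γ.len e
  ends : ∀ e,
    (Γ'.src (edge e) = vert (Γ.src e) ∧ Γ'.tgt (edge e) = vert (Γ.tgt e)) ∨
    (Γ'.src (edge e) = vert (Γ.tgt e) ∧ Γ'.tgt (edge e) = vert (Γ.src e))

namespace Iso

def refl (Γ : MetricGraph) : Iso Γ Γ :=
  ⟨Equiv.refl _, Equiv.refl _, fun _ => rfl, fun _ => Or.inl ⟨rfl, rfl⟩⟩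

def symm {Γ Γ' : MetricGraph} (i : Iso Γ Γ') : Iso Γ' Γ where
  vert := i.vert.symm
  edge := i.edge.symm
  len_eq e := by rw [← i.len_eq, Equiv.apply_symm_apply]
  ends e := by
    have h := i.ends (i.edge.symm e)
    rw [Equiv.apply_symm_apply] at h
    rcases h with ⟨h1, h2⟩ | ⟨h1, h2⟩
    · exact Or.inl ⟨by simp [h1], by simp [h2]⟩
    · exact Or.inr ⟨by simp [h2], by simp [h1]⟩

def trans {Γ Γ' Γ'' : MetricGraph} (i : Iso Γ Γ') (j : Iso Γ' Γ'') : Iso Γ Γ'' where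
  vert := i.vert.trans j.vert
  edge := i.edge.trans j.edge
  len_eq e := by simp [j.len_eq, i.len_eq]
  ends e := by
    have hi := i.ends e
    have hj := j.ends (i.edge e)
    rcases hi with ⟨h1, h2⟩ | ⟨h1, h2⟩ <;> rcases hj with ⟨k1, k2⟩ | ⟨k1, k2⟩ <;>
      simp [h1, h2, k1, k2]

end Iso

variable (Γ : MetricGraph)

/-! ### Points, divisors and ranks -/

/-- The points of the metric graph: its vertices and the interior points of its edges. -/
abbrev Point : Type := Γ.V ⊕ (Σ e : Γ.E, Set.Ioo (0 : ℝ) (Γ.len e))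

open Classical in
/-- For `0 ≤ t ≤ len e`, the point on the edge `e` at distance `t` from its source along `e`.
(For other values of `t` it is the nearer endpoint.) -/
def pt (e : Γ.E) (t : ℝ) : Γ.Point :=
  if h : 0 < t ∧ t < Γ.len e then Sum.inr ⟨e, t, h⟩
  else if t ≤ 0 then Sum.inl (Γ.src e) else Sum.inl (Γ.tgt e)

/-- The group of divisors. -/
abbrev Div : Type := Γ.Point →₀ ℤ

variable {Γ}

def Div.deg (D : Γ.Div) : ℤ := D.sum fun _ n => n

def Div.IsEffective (D : Γ.Div) : Prop := ∀ p, 0 ≤ D p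

variable (Γ)

/-- `f` is a piecewise linear function with integer slopes on `Γ`: at every point of every edge
it is linear on both sides. The integer `fwd e t` is the slope of `f` at the point `t` of `e` in
the direction of the target of `e`, and `bwd e t` is the slope in the direction of the source,
both outgoing from the point. By compactness of the edges only finitely many slopes occur on an
edge; continuity is automatic. -/
structure IsPL (f : Γ.Point → ℝ) (fwd bwd : Γ.E → ℝ → ℤ) : Prop where
  fwd_spec : ∀ e t, 0 ≤ t → t < Γ.len e →
    ∀ᶠ h : ℝ in 𝓝[>] 0, f (Γ.pt e (t + h)) = f (Γ.pt e t) + fwd e t * h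
  bwd_spec : ∀ e t, 0 < t → t ≤ Γ.len e →
    ∀ᶠ h : ℝ in 𝓝[>] 0, f (Γ.pt e (t - h)) = f (Γ.pt e t) + bwd e t * h

open Classical in
/-- The sum of the incoming slopes at a point, i.e. minus the sum of the outgoing slopes. -/
def ord (fwd bwd : Γ.E → ℝ → ℤ) : Γ.Point → ℤ
  | Sum.inl v => -((∑ e : Γ.E, if Γ.src e = v then fwd e 0 else 0) +
      ∑ e : Γ.E, if Γ.tgt e = v then bwd e (Γ.len e) else 0)
  | Sum.inr ⟨e, t⟩ => -(fwd e t + bwd e t)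

theorem ord_add (a b a' b' : Γ.E → ℝ → ℤ) (p : Γ.Point) :
    Γ.ord (a + a') (b + b') p = Γ.ord a b p + Γ.ord a' b' p := by
  classical
  rcases p with v | ⟨e, t⟩
  · simp only [ord, Pi.add_apply]
    have key : ∀ (P : Γ.E → Prop) [DecidablePred P] (x y : Γ.E → ℤ),
        (∑ e, if P e then x e + y e else 0) =
          (∑ e, if P e then x e else 0) + ∑ e, if P e then y e else 0 := by
      intro P _ x y
      rw [← Finset.sum_add_distrib]
      exact Finset.sum_congr rfl fun e _ => by split_ifs <;> simp
    rw [key, key]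
    ring
  · simp only [ord, Pi.add_apply]
    ring

theorem ord_neg (a b : Γ.E → ℝ → ℤ) (p : Γ.Point) :
    Γ.ord (-a) (-b) p = -Γ.ord a b p := by
  classical
  rcases p with v | ⟨e, t⟩
  · simp only [ord, Pi.neg_apply]
    have key : ∀ (P : Γ.E → Prop) [DecidablePred P] (x : Γ.E → ℤ),
        (∑ e, if P e then -x e else 0) = -∑ e, if P e then x e else 0 := by
      intro P _ x
      rw [← Finset.sum_neg_distrib]
      exact Finset.sum_congr rfl fun e _ => by split_ifs <;> simp
    rw [key, key]
    ring
  · simp only [ord, Pi.neg_apply]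
    ring

/-- The group of principal divisors, the divisors of piecewise linear functions with integer
slopes. -/
def Prin : AddSubgroup Γ.Div where
  carrier := {D | ∃ f fwd bwd, Γ.IsPL f fwd bwd ∧ ∀ p, D p = Γ.ord fwd bwd p}
  zero_mem' := by
    refine ⟨0, 0, 0, ⟨?_, ?_⟩, ?_⟩
    · intros; simp
    · intros; simp
    · rintro (v | ⟨e, t⟩) <;> simp [ord]
  add_mem' := by
    rintro D D' ⟨f, a, b, hf, h⟩ ⟨f', a', b', hf', h'⟩
    refine ⟨f + f', a + a', b + b', ⟨?_, ?_⟩, ?_⟩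
    · intro e t h0 h1
      filter_upwards [hf.fwd_spec e t h0 h1, hf'.fwd_spec e t h0 h1] with s hs hs'
      simp only [Pi.add_apply, hs, hs', Int.cast_add]
      ring
    · intro e t h0 h1
      filter_upwards [hf.bwd_spec e t h0 h1, hf'.bwd_spec e t h0 h1] with s hs hs'
      simp only [Pi.add_apply, hs, hs', Int.cast_add]
      ring
    · intro p
      rw [ord_add, Finsupp.add_apply, h, h']
  neg_mem' := by
    rintro D ⟨f, a, b, hf, h⟩
    refine ⟨-f, -a, -b, ⟨?_, ?_⟩, ?_⟩
    · intro e t h0 h1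
      filter_upwards [hf.fwd_spec e t h0 h1] with s hs
      simp only [Pi.neg_apply, hs, Int.cast_neg]
      ring
    · intro e t h0 h1
      filter_upwards [hf.bwd_spec e t h0 h1] with s hs
      simp only [Pi.neg_apply, hs, Int.cast_neg]
      ring
    · intro p
      rw [ord_neg, Finsupp.neg_apply, h]

/-- The Picard group. -/
abbrev Pic : Type := Γ.Div ⧸ Γ.Prin

/-- The class of a divisor in the Picard group. -/
abbrev cls (D : Γ.Div) : Γ.Pic := QuotientAddGroup.mk D

variable {Γ}

/-- The Baker-Norine rank: the largest `r` such that for every effective divisor `F` of degree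
`r` there is a divisor `D'` equivalent to `D` with `D' - F` effective. The value for a divisor
that is not equivalent to an effective one (usually written `-1`) is `⊥`. -/
def rank (D : Γ.Div) : WithBot ℕ∞ :=
  ⨆ r ∈ {r : ℕ | ∀ F : Γ.Div, F.IsEffective → F.deg = r →
    ∃ D' : Γ.Div, Γ.cls D' = Γ.cls D ∧ (D' - F).IsEffective}, ((r : ℕ∞) : WithBot ℕ∞)

variable (Γ)

/-- The Brill-Noether locus `W^r_d`: divisor classes of degree `d` and rank at least `r`. -/
def brillNoetherLocus (r d : ℕ) : Set Γ.Pic :=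
  {c | ∃ D : Γ.Div, Γ.cls D = c ∧ D.deg = d ∧ ((r : ℕ∞) : WithBot ℕ∞) ≤ rank D}

/-! ### The Abel-Jacobi map and dimensions of subsets of the Picard group -/

open Classical in
/-- Harmonic 1-forms: a real number for every oriented edge, changing sign with the orientation,
such that at every vertex the sum of the incoming values is zero. -/
def Harmonic : Submodule ℝ (Γ.E → ℝ) where
  carrier := {ω | ∀ v, (∑ e : Γ.E, ((if Γ.tgt e = v then ω e else 0) -
    (if Γ.src e = v then ω e else 0))) = 0}
  zero_mem' := by intro v; simp
  add_mem' := by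
    intro a b ha hb v
    have h : ∀ e : Γ.E, ((if Γ.tgt e = v then (a + b) e else 0) -
        (if Γ.src e = v then (a + b) e else 0)) =
        ((if Γ.tgt e = v then a e else 0) - (if Γ.src e = v then a e else 0)) +
        ((if Γ.tgt e = v then b e else 0) - (if Γ.src e = v then b e else 0)) := by
      intro e
      simp only [Pi.add_apply]
      split_ifs <;> ring
    rw [Finset.sum_congr rfl fun e _ => h e, Finset.sum_add_distrib, ha v, hb v, add_zero]
  smul_mem' := by
    intro c a ha v
    have h : ∀ e : Γ.E, ((if Γ.tgt e = v then (c • a) e else 0) -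
        (if Γ.src e = v then (c • a) e else 0)) =
        c * ((if Γ.tgt e = v then a e else 0) - (if Γ.src e = v then a e else 0)) := by
      intro e
      simp only [Pi.smul_apply, smul_eq_mul]
      split_ifs <;> ring
    rw [Finset.sum_congr rfl fun e _ => h e, ← Finset.mul_sum, ha v, mul_zero]

/-- The dual space of the space of harmonic 1-forms; it is the universal cover of the Jacobian
and of the torsors of divisor classes of given degree. -/
abbrev OmegaDual : Type := Module.Dual ℝ Γ.Harmonic

/-- An oriented segment contained in a closed edge, from the point `a` to the point `b`. -/
structure Segment where
  edge : Γ.E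
  a : ℝ
  b : ℝ
  a_mem : a ∈ Set.Icc 0 (Γ.len edge)
  b_mem : b ∈ Set.Icc 0 (Γ.len edge)

/-- Integral 1-chains on the metric graph. -/
abbrev Chain : Type := Γ.Segment →₀ ℤ

/-- The boundary of a 1-chain. -/
def boundary (c : Γ.Chain) : Γ.Div :=
  c.sum fun s n => Finsupp.single (Γ.pt s.edge s.b) n - Finsupp.single (Γ.pt s.edge s.a) n

/-- Integration of harmonic 1-forms along a 1-chain. -/
def integral (c : Γ.Chain) : Γ.OmegaDual :=
  c.sum fun s n =>
    ((n : ℝ) * (s.b - s.a)) • ((LinearMap.proj s.edge : (Γ.E → ℝ) →ₗ[ℝ] ℝ).domRestrict Γ.Harmonic)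

/-- The preimage in the universal cover of a set `S` of divisor classes of degree `d`. With the
base point `w`, the class of a divisor `D` of degree `d` is identified, by the Abel-Jacobi map,
with the class modulo periods of integration along any 1-chain with boundary `D - d w`. -/
def coverPreimage (w : Γ.Point) (d : ℕ) (S : Set Γ.Pic) : Set Γ.OmegaDual :=
  {x | ∃ D : Γ.Div, D.deg = d ∧ Γ.cls D ∈ S ∧
    ∃ c : Γ.Chain, Γ.boundary c = D - Finsupp.single w (d : ℤ) ∧ Γ.integral c = x}

/-- The dimension of a polyhedral set `S` of divisor classes of degree `d` (the image of a finite
union of polytopes in the universal cover): the largest dimension of a nonempty polytope whose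
image lies in `S`, i.e. the maximal dimension of a cell. It does not depend on the base point
`w`, and it is `⊥` for the empty set. -/
def polyDim (w : Γ.Point) (d : ℕ) (S : Set Γ.Pic) : WithBot ℕ∞ :=
  ⨆ T ∈ {T : Finset Γ.OmegaDual | T.Nonempty ∧
      convexHull ℝ (T : Set Γ.OmegaDual) ⊆ Γ.coverPreimage w d S},
    ((Module.finrank ℝ (vectorSpan ℝ (convexHull ℝ (T : Set Γ.OmegaDual))) : ℕ∞) : WithBot ℕ∞)

end MetricGraph

/-! ### The moduli space -/

open Classical in
/-- The metric graph with length function `ℓ` on `G`; the edges of length zero are contracted. -/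
def Multigraph.realize (G : Multigraph) (ℓ : G.E → ℝ) : MetricGraph where
  V := G.Components {e | ℓ e = 0}
  E := {e : G.E // 0 < ℓ e}
  fintypeV := Fintype.ofFinite _
  fintypeE := Fintype.ofFinite _
  src e := Quot.mk _ (G.src e)
  tgt e := Quot.mk _ (G.tgt e)
  len e := ℓ e
  len_pos e := e.2

/-- The disjoint union of the cones of length functions over all combinatorial types of metric
graphs of genus `g`, with the disjoint union topology. -/
abbrev ParamSpace (g : ℕ) : Type 1 :=
  Σ G : {G : Multigraph // G.IsStable g}, G.1.lengthCone

/-- The metric graph of a parameter. -/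
def ParamSpace.graph {g : ℕ} (p : ParamSpace g) : MetricGraph := p.1.1.realize p.2.1

/-- Two parameters are equivalent if their metric graphs are isomorphic. -/
def moduliSetoid (g : ℕ) : Setoid (ParamSpace g) where
  r p q := Nonempty (MetricGraph.Iso p.graph q.graph)
  iseqv :=
    { refl := fun _ => ⟨MetricGraph.Iso.refl _⟩
      symm := fun ⟨i⟩ => ⟨i.symm⟩
      trans := fun ⟨i⟩ ⟨j⟩ => ⟨i.trans j⟩ }

/-- The moduli space of metric graphs of genus `g`: the colimit of the cones of length functions
(glued along contractions and isomorphisms), with the quotient topology. -/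
abbrev Moduli (g : ℕ) : Type 1 := Quotient (moduliSetoid g)

/-- The metric graph `Γ` is in the isomorphism class `x`. -/
def MetricGraph.Represents (Γ : MetricGraph) {g : ℕ} (x : Moduli g) : Prop :=
  ∃ p : ParamSpace g, Quotient.mk (moduliSetoid g) p = x ∧ Nonempty (p.graph.Iso Γ)

/-- The moduli space of metric graphs of genus `g` without separating edges, as a subspace. -/
def bridgelessModuli (g : ℕ) : Set (Moduli g) :=
  {x | ∀ Γ : MetricGraph, Γ.Represents x → ∀ e : Γ.E, ¬ Γ.IsSeparating e}

/-- The loop of loops of genus 4: vertices `v i = inl i` and `w i = inr i`, an edge of length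
`ℓ i` from `v i` to `w i`, and two edges, of lengths `m i 0` and `m i 1`, from `w i` to
`v (i + 1)`, with cyclic indices `i : Fin 3`. -/
def loopOfLoops (ℓ : Fin 3 → ℝ) (m : Fin 3 → Fin 2 → ℝ) (hℓ : ∀ i, 0 < ℓ i)
    (hm : ∀ i j, 0 < m i j) : MetricGraph where
  V := Fin 3 ⊕ Fin 3
  E := Fin 3 ⊕ (Fin 3 × Fin 2)
  fintypeV := inferInstance
  fintypeE := inferInstance
  src := Sum.elim (fun i => Sum.inl i) (fun k => Sum.inr k.1)
  tgt := Sum.elim (fun i => Sum.inr i) (fun k => Sum.inl (k.1 + 1))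
  len := Sum.elim ℓ (fun k => m k.1 k.2)
  len_pos := by rintro (i | k); exacts [hℓ i, hm k.1 k.2]

/-- The isomorphism classes of loops of loops of genus 4 whose connecting edges satisfy
`ℓ₁ > ℓ₂ > ℓ₃` and `ℓ₂ + ℓ₃ > ℓ₁` (with indices shifted by one). -/
def loopOfLoopsLocus : Set (Moduli 4) :=
  {x | ∃ (ℓ : Fin 3 → ℝ) (m : Fin 3 → Fin 2 → ℝ) (hℓ : ∀ i, 0 < ℓ i) (hm : ∀ i j, 0 < m i j),
    ℓ 0 > ℓ 1 ∧ ℓ 1 > ℓ 2 ∧ ℓ 1 + ℓ 2 > ℓ 0 ∧ (loopOfLoops ℓ m hℓ hm).Represents x}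

/-- The Brill-Noether number. -/
def brillNoetherNumber (g r d : ℤ) : ℤ := g - (r + 1) * (g - d + r)

end

end TropicalBN

/-! Put one chip on each connecting edge, at distance `x i` from `v i`. Moving the three chips by
amounts that sum to zero is realized by a function that is constant on every loop, so the class
depends only on `c = ∑ x i` (`connectingDivisor_equiv`). If `ℓ i ≤ c ≤ ℓ (i + 1) + ℓ (i + 2)` for
all `i`, the class has rank at least one (`one_le_rank_connectingDivisor`). A chip can be placed
anywhere on the `i`-th connecting edge because the other two edges can absorb the rest of `c`. To
reach a loop, place chips at both of its ends, `w i` and `v (i + 1)`, and move them towards each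
other along either of its edges (`ends_equiv`). For lengths in the locus these bounds say `ℓ 0 ≤ c ≤
ℓ 1 + ℓ 2`, an interval of positive length by the triangle inequality. Varying `c` moves the class
along a nonconstant segment in the universal cover: the unit flow around the big cycle is a harmonic
form that is nonzero on the connecting edge where the chip moves (`polyDim_pos`). Openness holds
because these graphs have `3 g - 3 = 9` edges, the maximum for stable graphs. Hence any parameter
representing one has no contracted edge, and nearby parameters only change its lengths
(`isOpen_of_maximal`). Graphs in a moduli class are known only up to isomorphism, so constructions
on the model are transported along an `Iso`, with a sign for each reversed edge. -/

namespace TropicalBN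

noncomputable section

namespace MetricGraph

variable (Γ : MetricGraph)

/-! ### Points on edges -/

theorem pt_zero (e : Γ.E) : Γ.pt e 0 = Sum.inl (Γ.src e) := by
  simp [pt]

theorem pt_len (e : Γ.E) : Γ.pt e (Γ.len e) = Sum.inl (Γ.tgt e) := by
  simp [pt, (Γ.len_pos e).not_ge]

theorem pt_interior (e : Γ.E) (t : Set.Ioo (0 : ℝ) (Γ.len e)) :
    Γ.pt e t = Sum.inr ⟨e, t⟩ := by
  have h : (0 : ℝ) < t ∧ (t : ℝ) < Γ.len e := t.2
  simp [pt, h]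

theorem pt_eq_inl_iff (e : Γ.E) {t : ℝ} (ht : t ∈ Set.Icc 0 (Γ.len e)) (v : Γ.V) :
    Γ.pt e t = Sum.inl v ↔ (t = 0 ∧ Γ.src e = v) ∨ (t = Γ.len e ∧ Γ.tgt e = v) := by
  have hl := Γ.len_pos e
  rcases ht.1.eq_or_lt with rfl | h0
  · simp [pt_zero, hl.ne]
  rcases ht.2.eq_or_lt with rfl | h1
  · simp [pt_len, hl.ne']
  · simp [pt, h0, h1, h0.ne', h1.ne]

theorem pt_eq_inr_iff (e : Γ.E) {t : ℝ} (ht : t ∈ Set.Icc 0 (Γ.len e)) (e' : Γ.E)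
    (t' : Set.Ioo (0 : ℝ) (Γ.len e')) :
    Γ.pt e t = Sum.inr ⟨e', t'⟩ ↔ e = e' ∧ t = t' := by
  constructor
  · intro h
    rcases ht.1.eq_or_lt with rfl | h0
    · simp [pt_zero] at h
    rcases ht.2.eq_or_lt with rfl | h1
    · simp [pt_len] at h
    · simp only [pt, h0, h1, and_self, dite_true, Sum.inr.injEq] at h
      obtain ⟨rfl, h⟩ := Sigma.mk.inj_iff.1 h
      exact ⟨rfl, congrArg Subtype.val (eq_of_heq h)⟩
  · rintro ⟨rfl, rfl⟩
    exact Γ.pt_interior e t'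

theorem exists_eq_pt_of_edge (hV : ∀ v : Γ.V, ∃ e, Γ.src e = v ∨ Γ.tgt e = v) (p : Γ.Point) :
    ∃ e, ∃ t ∈ Set.Icc 0 (Γ.len e), p = Γ.pt e t := by
  rcases p with v | ⟨e, t⟩
  · obtain ⟨e, rfl | rfl⟩ := hV v
    · exact ⟨e, 0, ⟨le_rfl, (Γ.len_pos e).le⟩, (Γ.pt_zero e).symm⟩
    · exact ⟨e, Γ.len e, ⟨(Γ.len_pos e).le, le_rfl⟩, (Γ.pt_len e).symm⟩
  · exact ⟨e, t, ⟨t.2.1.le, t.2.2.le⟩, (Γ.pt_interior e t).symm⟩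

/-! ### Principal divisors from families of segments -/

variable {Γ}

namespace Segment

open Classical in
/-- The slope at `t`, towards the target of `e`, of the function that grows along `s`. -/
def fwd (s : Γ.Segment) (e : Γ.E) (t : ℝ) : ℤ :=
  if s.edge = e then (if t < s.b then 1 else 0) - (if t < s.a then 1 else 0) else 0

open Classical in
/-- The slope at `t`, towards the source of `e`, of the function that grows along `s`. -/
def bwd (s : Γ.Segment) (e : Γ.E) (t : ℝ) : ℤ :=
  if s.edge = e then (if t ≤ s.a then 1 else 0) - (if t ≤ s.b then 1 else 0) else 0

open Classical in
/-- The function on the edges of `Γ` with slope one along the segment `s` and constant elsewhere. -/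
def growth (s : Γ.Segment) (e : Γ.E) (t : ℝ) : ℝ :=
  if s.edge = e then min t s.b - min t s.a else 0

/-- The displacement along `e` of the segment `s`. -/
def disp (s : Γ.Segment) (e : Γ.E) : ℝ := s.growth e (Γ.len e)

open Classical in
theorem disp_eq (s : Γ.Segment) (e : Γ.E) : s.disp e = if s.edge = e then s.b - s.a else 0 := by
  unfold disp growth
  split_ifs with h
  · subst h
    rw [min_eq_right s.b_mem.2, min_eq_right s.a_mem.2]
  · rfl

theorem growth_zero (s : Γ.Segment) (e : Γ.E) : s.growth e 0 = 0 := by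
  simp [growth, s.a_mem.1, s.b_mem.1]

/-- The break point `t = b` counts as flat to the right and as sloped to the left; hence the strict
inequality in `fwd` and the weak one in `bwd`. -/
theorem eventually_min_add (t b : ℝ) :
    ∀ᶠ h : ℝ in 𝓝[>] 0, min (t + h) b = min t b + (if t < b then 1 else 0) * h := by
  split_ifs with hb
  · filter_upwards [Ioo_mem_nhdsGT (sub_pos.2 hb)] with h hh
    rw [min_eq_left (by linarith [hh.2]), min_eq_left hb.le, one_mul]
  · filter_upwards [self_mem_nhdsWithin] with h hh
    have : (0 : ℝ) < h := hh
    rw [min_eq_right (by linarith), min_eq_right (by linarith)]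
    ring

theorem eventually_min_sub (t b : ℝ) :
    ∀ᶠ h : ℝ in 𝓝[>] 0, min (t - h) b = min t b - (if t ≤ b then 1 else 0) * h := by
  split_ifs with hb
  · filter_upwards [self_mem_nhdsWithin] with h hh
    have : (0 : ℝ) < h := hh
    rw [min_eq_left (by linarith), min_eq_left hb, one_mul]
  · filter_upwards [Ioo_mem_nhdsGT (sub_pos.2 (not_le.1 hb))] with h hh
    rw [min_eq_right (by linarith [hh.2]), min_eq_right (by linarith)]
    ring

theorem eventually_growth_add (s : Γ.Segment) (e : Γ.E) (t : ℝ) :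
    ∀ᶠ h : ℝ in 𝓝[>] 0, s.growth e (t + h) = s.growth e t + s.fwd e t * h := by
  unfold growth fwd
  split_ifs with he
  all_goals try simp
  all_goals
    filter_upwards [eventually_min_add t s.b, eventually_min_add t s.a] with h hb ha
    rw [hb, ha]
    simp [*]
    try ring

theorem eventually_growth_sub (s : Γ.Segment) (e : Γ.E) (t : ℝ) :
    ∀ᶠ h : ℝ in 𝓝[>] 0, s.growth e (t - h) = s.growth e t + s.bwd e t * h := by
  unfold growth bwd
  split_ifs with he
  all_goals try simp
  all_goals
    filter_upwards [eventually_min_sub t s.b, eventually_min_sub t s.a] with h hb ha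
    rw [hb, ha]
    simp [*]
    try ring

/-- Growing along `s` gives one unit of incoming slope at its end and one unit of outgoing slope at
its start; elsewhere the slopes cancel. At the ends of the edge this is bookkeeping only: the
function need not close up around a loop. -/
theorem ord_fwd_bwd (s : Γ.Segment) (p : Γ.Point) :
    Γ.ord s.fwd s.bwd p =
      (Finsupp.single (Γ.pt s.edge s.b) 1 - Finsupp.single (Γ.pt s.edge s.a) 1 : Γ.Div) p := by
  classical
  have hl := Γ.len_pos s.edge
  rw [Finsupp.sub_apply, Finsupp.single_apply, Finsupp.single_apply]
  rcases p with v | ⟨e, t⟩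
  · have h1 : (∑ e, if Γ.src e = v then s.fwd e 0 else 0) =
        if Γ.src s.edge = v then (if 0 < s.b then 1 else 0) - (if 0 < s.a then 1 else 0) else 0 := by
      rw [Finset.sum_eq_single s.edge]
      · simp [fwd]
      · intro e _ he
        simp [fwd, he.symm]
      · simp
    have h2 : (∑ e, if Γ.tgt e = v then s.bwd e (Γ.len e) else 0) =
        if Γ.tgt s.edge = v then (if Γ.len s.edge ≤ s.a then 1 else 0) -
          (if Γ.len s.edge ≤ s.b then 1 else 0) else 0 := by
      rw [Finset.sum_eq_single s.edge]
      · simp [bwd]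
      · intro e _ he
        simp [bwd, he.symm]
      · simp
    -- The two ends are counted separately, so that the formula also holds when the edge is a loop
    -- at `v`.
    have key : ∀ t ∈ Set.Icc 0 (Γ.len s.edge),
        (if Γ.pt s.edge t = Sum.inl v then (1 : ℤ) else 0) =
          (if Γ.src s.edge = v then 1 - (if 0 < t then 1 else 0) else 0) +
          (if Γ.tgt s.edge = v then (if Γ.len s.edge ≤ t then 1 else 0) else 0) := by
      intro t ht
      simp only [Γ.pt_eq_inl_iff _ ht]
      rcases ht.1.eq_or_lt with rfl | h0
      · simp [hl.ne, hl.not_ge]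
      rcases ht.2.eq_or_lt with rfl | h1
      · simp [hl.ne', hl]
      · simp [h0, h1.ne, h1.not_ge, h0.ne']
    simp only [ord, h1, h2]
    rw [key _ s.a_mem, key _ s.b_mem]
    split_ifs <;> simp
  · simp only [ord, fwd, bwd, Γ.pt_eq_inr_iff _ s.a_mem, Γ.pt_eq_inr_iff _ s.b_mem]
    by_cases he : s.edge = e
    · have key : ∀ b : ℝ, (if b = t then (1 : ℤ) else 0) =
          (if (t : ℝ) ≤ b then 1 else 0) - (if (t : ℝ) < b then 1 else 0) := by
        intro b
        rcases lt_trichotomy b t with h | h | h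
        · simp [h.ne, h.not_ge, h.not_gt]
        · simp [h]
        · simp [h.ne', h.le, h]
      simp only [he, true_and, if_true, key]
      ring
    · simp [he]

end Segment

theorem ord_zero (p : Γ.Point) : Γ.ord 0 0 p = 0 := by
  rcases p with v | ⟨e, t⟩ <;> simp [ord]

theorem ord_sum {ι : Type*} (S : Finset ι) (a b : ι → Γ.E → ℝ → ℤ) (p : Γ.Point) :
    Γ.ord (∑ i ∈ S, a i) (∑ i ∈ S, b i) p = ∑ i ∈ S, Γ.ord (a i) (b i) p := by
  classical
  induction S using Finset.induction_on with
  | empty => simp [ord_zero]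
  | insert i S hi ih => rw [Finset.sum_insert hi, Finset.sum_insert hi, Finset.sum_insert hi,
      ord_add, ih]

/-- The boundary of a sum of segments is principal if its displacements are the differences of a
function on the vertices. -/
theorem sum_segments_mem_prin {ι : Type*} (S : Finset ι) (s : ι → Γ.Segment) (g : Γ.V → ℝ)
    (hg : ∀ e, ∑ i ∈ S, (s i).disp e = g (Γ.tgt e) - g (Γ.src e)) :
    ∑ i ∈ S, (Finsupp.single (Γ.pt (s i).edge (s i).b) 1 -
      Finsupp.single (Γ.pt (s i).edge (s i).a) 1) ∈ Γ.Prin := by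
  -- Integrate the slopes along each edge, starting from `g` at the source; `hg` says that the value
  -- reached at the target is again `g`, so the pieces glue at the vertices.
  let φ : Γ.E → ℝ → ℝ := fun e t => g (Γ.src e) + ∑ i ∈ S, (s i).growth e t
  let f : Γ.Point → ℝ := Sum.elim g fun q => φ q.1 q.2
  have hf : ∀ e, ∀ t ∈ Set.Icc 0 (Γ.len e), f (Γ.pt e t) = φ e t := by
    intro e t ht
    rcases ht.1.eq_or_lt with rfl | h0
    · simp [f, φ, pt_zero, Segment.growth_zero]
    rcases ht.2.eq_or_lt with rfl | h1
    · have := hg e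
      simp only [Segment.disp] at this
      simp [f, φ, pt_len, this]
    · rw [Γ.pt_interior e ⟨t, h0, h1⟩]
      simp [f]
  refine ⟨f, ∑ i ∈ S, (s i).fwd, ∑ i ∈ S, (s i).bwd, ⟨?_, ?_⟩, ?_⟩
  · intro e t h0 h1
    have hall := (Filter.eventually_all_finset S).2 fun i _ => (s i).eventually_growth_add e t
    filter_upwards [hall, Ioo_mem_nhdsGT (sub_pos.2 h1)] with h hh hm
    rw [hf e t ⟨h0, h1.le⟩, hf e (t + h) ⟨by linarith [hm.1], by linarith [hm.2]⟩]
    simp only [φ]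
    rw [Finset.sum_congr rfl hh, Finset.sum_add_distrib, ← Finset.sum_mul]
    simp [add_assoc]
  · intro e t h0 h1
    have hall := (Filter.eventually_all_finset S).2 fun i _ => (s i).eventually_growth_sub e t
    filter_upwards [hall, Ioo_mem_nhdsGT h0] with h hh hm
    rw [hf e t ⟨h0.le, h1⟩, hf e (t - h) ⟨by linarith [hm.2], by linarith [hm.1]⟩]
    simp only [φ]
    rw [Finset.sum_congr rfl hh, Finset.sum_add_distrib, ← Finset.sum_mul]
    simp [add_assoc]
  · intro p
    rw [ord_sum, Finsupp.finsetSum_apply]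
    exact Finset.sum_congr rfl fun i _ => ((s i).ord_fwd_bwd p).symm

/-! ### Chains between points of connected graphs -/

theorem boundary_add (c c' : Γ.Chain) : Γ.boundary (c + c') = Γ.boundary c + Γ.boundary c' := by
  classical
  refine Finsupp.sum_add_index' (by simp) ?_
  intro s m n
  rw [Finsupp.single_add, Finsupp.single_add]
  abel

theorem integral_add (c c' : Γ.Chain) : Γ.integral (c + c') = Γ.integral c + Γ.integral c' := by
  classical
  refine Finsupp.sum_add_index' (by simp) ?_
  intro s m n
  rw [← add_smul]
  push_cast
  ring_nf

theorem boundary_single (s : Γ.Segment) (n : ℤ) : Γ.boundary (Finsupp.single s n) =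
    Finsupp.single (Γ.pt s.edge s.b) n - Finsupp.single (Γ.pt s.edge s.a) n := by
  simp [boundary]

theorem integral_single (s : Γ.Segment) (n : ℤ) : Γ.integral (Finsupp.single s n) =
    ((n : ℝ) * (s.b - s.a)) •
      ((LinearMap.proj s.edge : (Γ.E → ℝ) →ₗ[ℝ] ℝ).domRestrict Γ.Harmonic) := by
  simp [integral]

variable (Γ) in
/-- The boundary as a homomorphism. -/
def boundaryHom : Γ.Chain →+ Γ.Div where
  toFun := Γ.boundary
  map_zero' := by simp [boundary]
  map_add' := boundary_add

/-- Paths: slide each point to a vertex of its edge and join the vertices by whole edges. This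
supplies the chains that `coverPreimage` asks for. -/
theorem single_sub_single_mem_range_boundaryHom (hΓ : Γ.IsConnected) (p q : Γ.Point) :
    (Finsupp.single p 1 - Finsupp.single q 1 : Γ.Div) ∈ (boundaryHom Γ).range := by
  have hsymm : ∀ p q : Γ.Point,
      (Finsupp.single p 1 - Finsupp.single q 1 : Γ.Div) ∈ (boundaryHom Γ).range →
      (Finsupp.single q 1 - Finsupp.single p 1 : Γ.Div) ∈ (boundaryHom Γ).range := by
    intro p q h
    simpa using neg_mem h
  have htrans : ∀ p q r : Γ.Point,
      (Finsupp.single p 1 - Finsupp.single q 1 : Γ.Div) ∈ (boundaryHom Γ).range →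
      (Finsupp.single q 1 - Finsupp.single r 1 : Γ.Div) ∈ (boundaryHom Γ).range →
      (Finsupp.single p 1 - Finsupp.single r 1 : Γ.Div) ∈ (boundaryHom Γ).range := by
    intro p q r h h'
    simpa using add_mem h h'
  have hseg : ∀ e, ∀ a ∈ Set.Icc 0 (Γ.len e), ∀ b ∈ Set.Icc 0 (Γ.len e),
      (Finsupp.single (Γ.pt e b) 1 - Finsupp.single (Γ.pt e a) 1 : Γ.Div) ∈
        (boundaryHom Γ).range :=
    fun e a ha b hb => ⟨Finsupp.single ⟨e, a, b, ha, hb⟩ 1, boundary_single _ _⟩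
  have hpt : ∀ p : Γ.Point, ∃ v,
      (Finsupp.single p 1 - Finsupp.single (Sum.inl v) 1 : Γ.Div) ∈ (boundaryHom Γ).range := by
    rintro (v | ⟨e, t⟩)
    · exact ⟨v, by simp⟩
    · refine ⟨Γ.src e, ?_⟩
      rw [← Γ.pt_zero, ← Γ.pt_interior]
      exact hseg e 0 ⟨le_rfl, (Γ.len_pos e).le⟩ t ⟨t.2.1.le, t.2.2.le⟩
  have hV : ∀ u v : Γ.V, (Finsupp.single (Sum.inl u) 1 - Finsupp.single (Sum.inl v) 1 : Γ.Div) ∈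
      (boundaryHom Γ).range := by
    intro u v
    have := (Nat.card_eq_one_iff_unique.1 hΓ).1
    have huv := Quot.eqvGen_exact (Subsingleton.elim
      (Quot.mk _ u : Γ.Components Set.univ) (Quot.mk _ v))
    induction huv with
    | rel u v h =>
      obtain ⟨e, -, rfl, rfl⟩ := h
      rw [← Γ.pt_zero, ← Γ.pt_len]
      exact hseg e _ ⟨(Γ.len_pos e).le, le_rfl⟩ _ ⟨le_rfl, (Γ.len_pos e).le⟩
    | refl u => simp
    | symm u v _ ih => exact hsymm _ _ ih
    | trans u v w _ _ ih ih' => exact htrans _ _ _ ih ih'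
  obtain ⟨u, hu⟩ := hpt p
  obtain ⟨v, hv⟩ := hpt q
  exact htrans _ _ _ hu (htrans _ _ _ (hV u v) (hsymm _ _ hv))

/-! ### Degrees and ranks -/

theorem deg_add (D D' : Γ.Div) : (D + D').deg = D.deg + D'.deg := by
  classical
  exact Finsupp.sum_add_index' (by simp) (by simp)

theorem deg_single (p : Γ.Point) (n : ℤ) : Div.deg (Finsupp.single p n : Γ.Div) = n := by
  simp [Div.deg]

theorem cls_eq_of_sub_mem {D D' : Γ.Div} (h : D' - D ∈ Γ.Prin) : Γ.cls D' = Γ.cls D :=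
  (QuotientAddGroup.eq_iff_sub_mem).2 h

/-- An effective divisor of degree one is a single point. -/
theorem one_le_rank {D : Γ.Div}
    (h : ∀ p, ∃ D' : Γ.Div, D'.IsEffective ∧ Γ.cls (Finsupp.single p 1 + D') = Γ.cls D) :
    ((1 : ℕ) : WithBot ℕ∞) ≤ rank D := by
  classical
  refine le_iSup₂ (f := fun (r : ℕ) (_ : r ∈ {r : ℕ | ∀ F : Γ.Div, F.IsEffective → F.deg = r →
    ∃ D' : Γ.Div, Γ.cls D' = Γ.cls D ∧ (D' - F).IsEffective}) => ((r : ℕ∞) : WithBot ℕ∞)) 1 ?_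
  intro F hF hd
  have hdeg : ∑ p ∈ F.support, F p = 1 := by simpa [Div.deg, Finsupp.sum] using hd
  obtain ⟨p, hp⟩ : ∃ p, F p ≠ 0 := by
    by_contra! hF0
    simp [hF0] at hdeg
  have hFp : F = Finsupp.single p 1 := by
    have hps : p ∈ F.support := Finsupp.mem_support_iff.2 hp
    have hp1 : 1 ≤ F p := lt_of_le_of_ne (hF p) (Ne.symm hp)
    rw [← Finset.add_sum_erase _ _ hps] at hdeg
    have hnn : ∀ q ∈ F.support.erase p, 0 ≤ F q := fun q _ => hF q
    have hs : ∑ q ∈ F.support.erase p, F q = 0 :=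
      le_antisymm (by linarith) (Finset.sum_nonneg hnn)
    have hz := (Finset.sum_eq_zero_iff_of_nonneg hnn).1 hs
    ext q
    rw [Finsupp.single_apply]
    split_ifs with hq
    · subst hq
      linarith
    · by_contra hq0
      exact hq0 (hz q (Finset.mem_erase.2 ⟨Ne.symm hq, Finsupp.mem_support_iff.2 hq0⟩))
  obtain ⟨D', hD', hc⟩ := h p
  refine ⟨_, hc, ?_⟩
  rw [hFp, add_sub_cancel_left]
  exact hD'

theorem isEffective_single (p : Γ.Point) : Div.IsEffective (Finsupp.single p 1 : Γ.Div) := by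
  classical
  intro q
  rw [Finsupp.single_apply]
  split_ifs <;> simp

theorem Div.IsEffective.add {D D' : Γ.Div} (h : D.IsEffective) (h' : D'.IsEffective) :
    (D + D').IsEffective := fun p => add_nonneg (h p) (h' p)

/-! ### Transport along isomorphisms -/

namespace Iso

variable {Γ₀ Γ : MetricGraph} (i : Iso Γ₀ Γ)

open Classical in
/-- The sign with which an isomorphism maps the orientation of an edge. -/
def sign (k : Γ₀.E) : ℝ :=
  if Γ.src (i.edge k) = i.vert (Γ₀.src k) ∧ Γ.tgt (i.edge k) = i.vert (Γ₀.tgt k) then 1 else -1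

theorem sign_cases (k : Γ₀.E) :
    (i.sign k = 1 ∧ Γ.src (i.edge k) = i.vert (Γ₀.src k) ∧
      Γ.tgt (i.edge k) = i.vert (Γ₀.tgt k)) ∨
    (i.sign k = -1 ∧ Γ.src (i.edge k) = i.vert (Γ₀.tgt k) ∧
      Γ.tgt (i.edge k) = i.vert (Γ₀.src k)) := by
  unfold sign
  split_ifs with h
  · exact Or.inl ⟨rfl, h⟩
  · exact Or.inr ⟨rfl, (i.ends k).resolve_left h⟩

theorem sign_ne_zero (k : Γ₀.E) : i.sign k ≠ 0 := by
  rcases i.sign_cases k with ⟨h, -⟩ | ⟨h, -⟩ <;> simp [h]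

/-- The coordinate of the image of the point `t` of the edge `k`. -/
def param (k : Γ₀.E) (t : ℝ) : ℝ :=
  (1 - i.sign k) / 2 * Γ₀.len k + i.sign k * t

theorem param_mem (k : Γ₀.E) {t : ℝ} (ht : t ∈ Set.Icc 0 (Γ₀.len k)) :
    i.param k t ∈ Set.Icc 0 (Γ.len (i.edge k)) := by
  rw [i.len_eq, param]
  rcases i.sign_cases k with ⟨h, -⟩ | ⟨h, -⟩ <;> rw [h] <;>
    constructor <;> linarith [ht.1, ht.2]

/-- The image of a point on an edge. -/
def point (k : Γ₀.E) (t : ℝ) : Γ.Point := Γ.pt (i.edge k) (i.param k t)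

theorem point_zero (k : Γ₀.E) : i.point k 0 = Sum.inl (i.vert (Γ₀.src k)) := by
  unfold point param
  rcases i.sign_cases k with ⟨h, h1, h2⟩ | ⟨h, h1, h2⟩ <;> rw [h]
  · norm_num [pt_zero, h1]
  · norm_num [← i.len_eq, pt_len, h2]

theorem point_len (k : Γ₀.E) : i.point k (Γ₀.len k) = Sum.inl (i.vert (Γ₀.tgt k)) := by
  unfold point param
  rcases i.sign_cases k with ⟨h, h1, h2⟩ | ⟨h, h1, h2⟩ <;> rw [h]
  · norm_num [← i.len_eq, pt_len, h2]
  · norm_num [pt_zero, h1]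

theorem exists_eq_point (hV : ∀ v : Γ₀.V, ∃ k, Γ₀.src k = v ∨ Γ₀.tgt k = v) (p : Γ.Point) :
    ∃ k, ∃ t ∈ Set.Icc 0 (Γ₀.len k), p = i.point k t := by
  obtain ⟨e, t, ht, rfl⟩ := Γ.exists_eq_pt_of_edge (by
    intro v
    obtain ⟨k, hk⟩ := hV (i.vert.symm v)
    refine ⟨i.edge k, ?_⟩
    rw [Equiv.eq_symm_apply, Equiv.eq_symm_apply] at hk
    rcases i.ends k with ⟨h1, h2⟩ | ⟨h1, h2⟩ <;> rw [h1, h2] <;> tauto) p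
  obtain ⟨k, rfl⟩ := i.edge.surjective e
  rw [i.len_eq] at ht
  -- The coordinate change is the identity or `t ↦ len - t`, hence its own inverse.
  refine ⟨k, (1 - i.sign k) / 2 * Γ₀.len k + i.sign k * t, ?_, ?_⟩
  · rcases i.sign_cases k with ⟨h, -⟩ | ⟨h, -⟩ <;> rw [h] <;>
      constructor <;> linarith [ht.1, ht.2]
  · unfold point param
    congr 1
    rcases i.sign_cases k with ⟨h, -⟩ | ⟨h, -⟩ <;> rw [h] <;> ring

/-- Intervals in the coordinates of an edge correspond to intervals on the image. -/
theorem exists_param_Icc (k : Γ₀.E) {a b : ℝ} (hab : a < b) :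
    ∃ a' b', a' < b' ∧ ∀ t' ∈ Set.Icc a' b', ∃ t ∈ Set.Icc a b, i.param k t = t' := by
  rcases i.sign_cases k with ⟨h, -⟩ | ⟨h, -⟩
  · refine ⟨a, b, hab, fun t ht => ⟨t, ht, ?_⟩⟩
    rw [param, h]
    ring
  · refine ⟨Γ₀.len k - b, Γ₀.len k - a, by linarith, fun t ht =>
      ⟨Γ₀.len k - t, ⟨by linarith [ht.2], by linarith [ht.1]⟩, ?_⟩⟩
    rw [param, h]
    ring

/-- The image of a segment. -/
def segment (s : Γ₀.Segment) : Γ.Segment :=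
  ⟨i.edge s.edge, i.param s.edge s.a, i.param s.edge s.b, i.param_mem _ s.a_mem,
    i.param_mem _ s.b_mem⟩

theorem disp_segment (s : Γ₀.Segment) (k : Γ₀.E) :
    (i.segment s).disp (i.edge k) = i.sign k * s.disp k := by
  rw [Segment.disp_eq, Segment.disp_eq]
  by_cases h : s.edge = k
  · subst h
    simp only [segment, param, if_true]
    ring
  · simp [segment, h]

/-- The image of the boundary of a sum of segments is principal if the displacements are the
differences of a function on the vertices. -/
theorem sum_segments_mem_prin {ι : Type*} (S : Finset ι) (s : ι → Γ₀.Segment) (g : Γ₀.V → ℝ)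
    (hg : ∀ k, ∑ j ∈ S, (s j).disp k = g (Γ₀.tgt k) - g (Γ₀.src k)) :
    ∑ j ∈ S, (Finsupp.single (i.point (s j).edge (s j).b) 1 -
      Finsupp.single (i.point (s j).edge (s j).a) 1) ∈ Γ.Prin := by
  refine MetricGraph.sum_segments_mem_prin S (fun j => i.segment (s j)) (g ∘ i.vert.symm) ?_
  intro e
  obtain ⟨k, rfl⟩ := i.edge.surjective e
  simp only [disp_segment, ← Finset.mul_sum, hg]
  rcases i.sign_cases k with ⟨h, h1, h2⟩ | ⟨h, h1, h2⟩ <;> rw [h] <;> simp [h1, h2]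

/-- Reversing an edge changes the sign of the form and swaps source and target, so the contribution
to each vertex is unchanged. -/
theorem mem_harmonic {ω : Γ₀.E → ℝ} (hω : ω ∈ Γ₀.Harmonic) :
    (fun e => i.sign (i.edge.symm e) * ω (i.edge.symm e)) ∈ Γ.Harmonic := by
  classical
  intro v
  obtain ⟨u, rfl⟩ := i.vert.surjective v
  rw [← i.edge.sum_comp]
  refine Eq.trans ?_ (hω u)
  refine Finset.sum_congr rfl fun k _ => ?_
  rcases i.sign_cases k with ⟨h, h1, h2⟩ | ⟨h, h1, h2⟩ <;> simp only [h, h1, h2,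
    i.vert.apply_eq_iff_eq, Equiv.symm_apply_apply] <;> split_ifs <;> ring

/-- The vertex bijection induces a surjection on components. -/
theorem card_components_eq_one {I : Set Γ₀.E} {J : Set Γ.E} (hIJ : ∀ k ∈ I, i.edge k ∈ J)
    (hI : Nat.card (Γ₀.Components I) = 1) : Nat.card (Γ.Components J) = 1 := by
  obtain ⟨hs, hn⟩ := Nat.card_eq_one_iff_unique.1 hI
  let φ : Γ₀.Components I → Γ.Components J :=
    Quot.lift (fun u => Quot.mk _ (i.vert u)) (by
      rintro _ _ ⟨k, hk, rfl, rfl⟩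
      rcases i.ends k with ⟨h1, h2⟩ | ⟨h1, h2⟩
      · exact Quot.sound ⟨_, hIJ k hk, h1, h2⟩
      · exact (Quot.sound ⟨_, hIJ k hk, h1, h2⟩).symm)
  have hφ : Function.Surjective φ := by
    rintro ⟨v⟩
    exact ⟨Quot.mk _ (i.vert.symm v), by simp [φ]⟩
  exact Nat.card_eq_one_iff_unique.2 ⟨hφ.subsingleton, hn.map φ⟩

theorem isConnected (i : Iso Γ₀ Γ) (h : Γ₀.IsConnected) : Γ.IsConnected :=
  i.card_components_eq_one (fun _ _ => Set.mem_univ _) h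

end Iso

/-! ### Positive dimension -/

variable {Γ : MetricGraph}

/-- A set of divisor classes has positive dimension if it contains the classes of the divisors
obtained by moving a chip along a segment of an edge on which some harmonic form is nonzero. -/
theorem polyDim_pos (hΓ : Γ.IsConnected) (w : Γ.Point) {d : ℕ} {S : Set Γ.Pic} {e : Γ.E}
    {ω : Γ.E → ℝ} (hω : ω ∈ Γ.Harmonic) (hωe : ω e ≠ 0) {a b : ℝ} (hab : a < b)
    (hI : Set.Icc a b ⊆ Set.Icc 0 (Γ.len e)) (D : Γ.Div)
    (hd : ∀ t ∈ Set.Icc a b, Div.deg (Finsupp.single (Γ.pt e t) 1 + D) = d)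
    (hS : ∀ t ∈ Set.Icc a b, Γ.cls (Finsupp.single (Γ.pt e t) 1 + D) ∈ S) :
    0 < Γ.polyDim w d S := by
  classical
  have haI : a ∈ Set.Icc a b := ⟨le_rfl, hab.le⟩
  have hbase : ∀ F : Γ.Div, F - Finsupp.single w F.deg ∈ (boundaryHom Γ).range := by
    intro F
    have hF : F - Finsupp.single w F.deg =
        ∑ p ∈ F.support, F p • (Finsupp.single p 1 - Finsupp.single w 1 : Γ.Div) := by
      simp only [smul_sub, Finset.sum_sub_distrib, Finsupp.smul_single, smul_eq_mul, mul_one]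
      rw [← Finsupp.single_finsetSum]
      congr 1
      exact (Finsupp.sum_single F).symm
    rw [hF]
    exact sum_mem fun p _ => zsmul_mem (single_sub_single_mem_range_boundaryHom hΓ p w) _
  obtain ⟨c₀, hc₀⟩ := hbase (Finsupp.single (Γ.pt e a) 1 + D)
  replace hc₀ : Γ.boundary c₀ = _ := hc₀
  rw [hd a haI] at hc₀
  -- Direction in which the lift moves with the chip: appending the segment from `a` to `t` adds `(t
  -- - a) • ev` to the integral. It is nonzero because `ω e ≠ 0`.
  let ev : Γ.OmegaDual := (LinearMap.proj e : (Γ.E → ℝ) →ₗ[ℝ] ℝ).domRestrict Γ.Harmonic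
  have hev : ev ≠ 0 := fun h => hωe (congrArg (fun l : Γ.OmegaDual => l ⟨ω, hω⟩) h)
  have hmem : ∀ t ∈ Set.Icc a b, Γ.integral c₀ + (t - a) • ev ∈ Γ.coverPreimage w d S := by
    intro t ht
    refine ⟨_, hd t ht, hS t ht, c₀ + Finsupp.single ⟨e, a, t, hI haI, hI ht⟩ 1, ?_, ?_⟩
    · rw [boundary_add, boundary_single, hc₀]
      abel
    · rw [integral_add, integral_single]
      simp [ev]
  let x := Γ.integral c₀
  let y := Γ.integral c₀ + (b - a) • ev
  have hyx : y - x ≠ 0 := by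
    simp [x, y, hev, sub_eq_zero, hab.ne']
  have hsub : convexHull ℝ (({x, y} : Finset Γ.OmegaDual) : Set Γ.OmegaDual) ⊆
      Γ.coverPreimage w d S := by
    rw [Finset.coe_pair, convexHull_pair, segment_eq_image']
    rintro _ ⟨θ, hθ, rfl⟩
    have := hmem (a + θ * (b - a)) ⟨by nlinarith [hθ.1], by nlinarith [hθ.2]⟩
    convert this using 2
    simp [x, y, smul_smul]
  have hpos : 0 < Module.finrank ℝ
      (vectorSpan ℝ (convexHull ℝ (({x, y} : Finset Γ.OmegaDual) : Set Γ.OmegaDual))) := by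
    have hm : y - x ∈
        vectorSpan ℝ (convexHull ℝ (({x, y} : Finset Γ.OmegaDual) : Set Γ.OmegaDual)) :=
      vsub_mem_vectorSpan ℝ (subset_convexHull ℝ _ (by simp)) (subset_convexHull ℝ _ (by simp))
    exact Submodule.one_le_finrank_iff.2 fun h => hyx ((Submodule.eq_bot_iff _).1 h _ hm)
  refine lt_of_lt_of_le ?_ (le_iSup₂ (f := fun (T : Finset Γ.OmegaDual)
    (_ : T ∈ {T : Finset Γ.OmegaDual | T.Nonempty ∧
      convexHull ℝ (T : Set Γ.OmegaDual) ⊆ Γ.coverPreimage w d S}) =>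
    ((Module.finrank ℝ (vectorSpan ℝ (convexHull ℝ (T : Set Γ.OmegaDual))) : ℕ∞) : WithBot ℕ∞))
    {x, y} ⟨by simp, hsub⟩)
  exact_mod_cast hpos

end MetricGraph

/-! ### Counting edges of stable graphs -/

namespace Multigraph

variable (G : Multigraph)

theorem sum_valence : ∑ v, G.valence v = 2 * Nat.card G.E := by
  classical
  simp only [valence, Finset.sum_add_distrib, two_mul]
  congr 1
  · rw [← Nat.card_congr (Equiv.sigmaFiberEquiv G.src), Nat.card_sigma]
  · rw [← Nat.card_congr (Equiv.sigmaFiberEquiv G.tgt), Nat.card_sigma]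

variable {G}

/-- Combine `3 |V| ≤ 2 |E|`, from the valence sum, with `|E| - |V| + 1 = g`. -/
theorem IsStable.card_edges_le {g : ℕ} (h : G.IsStable g) : (Nat.card G.E : ℤ) ≤ 3 * g - 3 := by
  have h1 := h.genus_eq
  have h2 : Nat.card (G.Components Set.univ) = 1 := h.connected
  rw [genus, betti, h2, Nat.card_congr (Equiv.Set.univ G.E)] at h1
  have h3 : Nat.card G.V * 3 ≤ 2 * Nat.card G.E := by
    rw [← sum_valence, Nat.card_eq_fintype_card, ← Finset.card_univ, ← smul_eq_mul]
    exact Finset.card_nsmul_le_sum _ _ _ fun v _ => h.three_le_valence v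
  push_cast at h1
  omega

variable (G)

/-- Without edges, every vertex is a component. -/
def componentsEmptyEquiv {I : Set G.E} (hI : I = ∅) : G.Components I ≃ G.V where
  toFun := Quot.lift id (by rintro _ _ ⟨e, he, -⟩; simp [hI] at he)
  invFun := Quot.mk _
  left_inv := by rintro ⟨v⟩; rfl
  right_inv _ := rfl

theorem betti_empty : G.betti ∅ = 0 := by
  simp [betti, Nat.card_congr (G.componentsEmptyEquiv rfl)]

variable {G}

theorem zeros_eq_empty {ℓ : G.E → ℝ} (h : ∀ e, 0 < ℓ e) : {e | ℓ e = 0} = ∅ :=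
  Set.eq_empty_of_forall_notMem fun e he => (h e).ne' he

theorem mem_lengthCone_of_pos {ℓ : G.E → ℝ} (h : ∀ e, 0 < ℓ e) : ℓ ∈ G.lengthCone :=
  ⟨fun e => (h e).le, by rw [zeros_eq_empty h, betti_empty]⟩

end Multigraph

/-! ### Realizations, representatives and openness in the moduli space -/

namespace MetricGraph

/-- A metric graph is the realization of its length function. -/
def realizeIso (Γ : MetricGraph) : Iso (Γ.toMultigraph.realize Γ.len) Γ where
  vert := Γ.componentsEmptyEquiv (Multigraph.zeros_eq_empty Γ.len_pos)
  edge := Equiv.subtypeUnivEquiv Γ.len_pos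
  len_eq _ := rfl
  ends _ := Or.inl ⟨rfl, rfl⟩

/-- A metric graph with new edge lengths. -/
def withLen (Γ : MetricGraph) (len : Γ.E → ℝ) (h : ∀ e, 0 < len e) : MetricGraph :=
  { Γ with len := len, len_pos := h }

/-- An isomorphism from a realization without contracted edges gives one for all positive
lengths. -/
def Iso.changeLen {G : Multigraph} {ℓ ℓ' : G.E → ℝ} {Γ : MetricGraph} (i : Iso (G.realize ℓ) Γ)
    (h : ∀ e, 0 < ℓ e) (h' : ∀ e, 0 < ℓ' e) :
    Iso (G.realize ℓ') (Γ.withLen (fun e => ℓ' (i.edge.symm e).1) fun _ => h' _) where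
  vert := ((G.componentsEmptyEquiv (Multigraph.zeros_eq_empty h')).trans
    (G.componentsEmptyEquiv (Multigraph.zeros_eq_empty h)).symm).trans i.vert
  edge := ((Equiv.subtypeUnivEquiv h').trans (Equiv.subtypeUnivEquiv h).symm).trans i.edge
  len_eq e := congrArg (fun x : {e : G.E // 0 < ℓ e} => ℓ' x.1)
    (i.edge.symm_apply_apply ⟨e.1, h _⟩)
  ends e := i.ends ⟨e.1, h _⟩

theorem Represents.nonempty_iso {Γ Γ' : MetricGraph} {g : ℕ} {x : Moduli g}
    (h : Γ.Represents x) (h' : Γ'.Represents x) : Nonempty (Iso Γ Γ') := by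
  obtain ⟨p, rfl, ⟨i⟩⟩ := h
  obtain ⟨q, hq, ⟨j⟩⟩ := h'
  obtain ⟨k⟩ := Quotient.exact hq
  exact ⟨(i.symm.trans k.symm).trans j⟩

theorem represents_mk_iff {Γ : MetricGraph} {g : ℕ} (p : ParamSpace g) :
    Γ.Represents (Quotient.mk (moduliSetoid g) p) ↔ Nonempty (Iso p.graph Γ) := by
  constructor
  · intro h
    exact Represents.nonempty_iso ⟨p, rfl, ⟨Iso.refl _⟩⟩ h
  · exact fun h => ⟨p, rfl, h⟩

theorem exists_represents {Γ : MetricGraph} {g : ℕ} (h : Γ.toMultigraph.IsStable g) :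
    ∃ x : Moduli g, Γ.Represents x :=
  ⟨_, ⟨⟨Γ.toMultigraph, h⟩, Γ.len, Multigraph.mem_lengthCone_of_pos Γ.len_pos⟩, rfl,
    ⟨Γ.realizeIso⟩⟩

end MetricGraph

open MetricGraph

/-- A locus of metric graphs with the maximal number of edges is open if it is defined by open
conditions on the edge lengths. -/
theorem isOpen_of_maximal {g : ℕ} (U : Set (Moduli g))
    (hU : ∀ x ∈ U, ∃ Γ : MetricGraph, Γ.Represents x ∧ (Nat.card Γ.E : ℤ) = 3 * g - 3 ∧
      ∃ N : Set (Γ.E → ℝ), IsOpen N ∧ Γ.len ∈ N ∧ ∀ len ∈ N, ∀ h : ∀ e, 0 < len e,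
        ∀ y : Moduli g, (Γ.withLen len h).Represents y → y ∈ U) : IsOpen U := by
  rw [← isQuotientMap_quotient_mk'.isOpen_preimage, isOpen_sigma_iff]
  rintro ⟨G, hG⟩
  rw [isOpen_iff_mem_nhds]
  rintro ⟨ℓ, hℓ⟩ hx
  obtain ⟨Γ, hΓ, hcard, N, hN, hlen, hNU⟩ := hU _ hx
  obtain ⟨i⟩ := (represents_mk_iff _).1 hΓ
  change Iso (G.realize ℓ) Γ at i
  -- `G` has at most `3 g - 3` edges, and `3 g - 3` of them survive the contraction; so none is
  -- contracted.
  have hpos : ∀ e, 0 < ℓ e := by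
    have hle := hG.card_edges_le
    rw [← hcard, ← Nat.card_congr i.edge] at hle
    change (Nat.card G.E : ℤ) ≤ (Nat.card {e : G.E // 0 < ℓ e} : ℕ) at hle
    have hbij := (Subtype.val_injective (p := fun e : G.E => 0 < ℓ e)).bijective_of_nat_card_le
      (by exact_mod_cast hle)
    intro e
    obtain ⟨e', rfl⟩ := hbij.2 e
    exact e'.2
  have hcont : Continuous fun (ℓ' : G.lengthCone) (e : Γ.E) => ℓ'.1 (i.edge.symm e).1 :=
    continuous_pi fun e => (continuous_apply _).comp continuous_subtype_val
  have hmem : (fun e : Γ.E => ℓ (i.edge.symm e).1) ∈ N := by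
    convert hlen using 1
    funext e
    have := i.len_eq (i.edge.symm e)
    rw [Equiv.apply_symm_apply] at this
    exact this.symm
  have h1 : ∀ᶠ ℓ' : G.lengthCone in 𝓝 ⟨ℓ, hℓ⟩, ∀ e, 0 < ℓ'.1 e :=
    Filter.eventually_all.2 fun e =>
      (((continuous_apply e).comp continuous_subtype_val).tendsto _).eventually
        (lt_mem_nhds (hpos e))
  filter_upwards [hcont.continuousAt.preimage_mem_nhds (hN.mem_nhds hmem), h1] with ℓ' hℓN hℓp
  exact hNU _ hℓN (fun _ => hℓp _) _ ((represents_mk_iff _).2 ⟨i.changeLen hpos hℓp⟩)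

/-! ### Three cyclic indices -/

theorem fin_three_cases : ∀ i j : Fin 3, j = i ∨ j = i + 1 ∨ j = i + 2 := by
  decide

theorem sum_fin_three_cyclic {M : Type*} [AddCommMonoid M] (F : Fin 3 → M) (i : Fin 3) :
    ∑ j, F j = F i + (F (i + 1) + F (i + 2)) := by
  rw [Fin.sum_univ_three]
  fin_cases i
  · exact add_assoc _ _ _
  · change F 0 + F 1 + F 2 = F 1 + (F 2 + F 0)
    abel
  · change F 0 + F 1 + F 2 = F 2 + (F 0 + F 1)
    abel

/-- Functions on three cyclic indices can be prescribed from any starting index. -/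
theorem exists_fin_three_cyclic {α : Type*} (i : Fin 3) (a b c : α) :
    ∃ F : Fin 3 → α, F i = a ∧ F (i + 1) = b ∧ F (i + 2) = c :=
  ⟨fun j => if j = i then a else if j = i + 1 then b else c, by simp,
    by fin_cases i <;> simp, by fin_cases i <;> rfl⟩

theorem forall_fin_three_cyclic {p : Fin 3 → Prop} (i : Fin 3) (h0 : p i) (h1 : p (i + 1))
    (h2 : p (i + 2)) (j : Fin 3) : p j := by
  rcases fin_three_cases i j with rfl | rfl | rfl <;> assumption

/-! ### Loops of loops -/

section LoopOfLoops

variable (ℓ : Fin 3 → ℝ) (m : Fin 3 → Fin 2 → ℝ) (hℓ : ∀ i, 0 < ℓ i) (hm : ∀ i j, 0 < m i j)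

/-- A subgraph of a loop of loops is connected if it contains two of the three connecting edges
and an edge of each of the loops. -/
theorem card_components_loopOfLoops {I : Set (loopOfLoops ℓ m hℓ hm).E} (i₀ : Fin 3)
    (h : ∀ i, i ≠ i₀ → Sum.inl i ∈ I) (h' : ∀ i, ∃ j, Sum.inr (i, j) ∈ I) :
    Nat.card ((loopOfLoops ℓ m hℓ hm).Components I) = 1 := by
  let q : Fin 3 ⊕ Fin 3 → (loopOfLoops ℓ m hℓ hm).Components I := Quot.mk _
  have hvw : ∀ i, i ≠ i₀ → q (Sum.inl i) = q (Sum.inr i) :=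
    fun i hi => Quot.sound ⟨Sum.inl i, h i hi, rfl, rfl⟩
  have hwv : ∀ i, q (Sum.inr i) = q (Sum.inl (i + 1)) := by
    intro i
    obtain ⟨j, hj⟩ := h' i
    exact Quot.sound ⟨Sum.inr (i, j), hj, rfl, rfl⟩
  -- Walk from `w i₀` around the big cycle, which ends before the connecting edge `i₀` is needed.
  have hw : ∀ i, q (Sum.inr i) = q (Sum.inr i₀) := by
    have h1 : q (Sum.inr i₀) = q (Sum.inr (i₀ + 1)) :=
      (hwv i₀).trans (hvw _ ((by decide : ∀ i : Fin 3, i + 1 ≠ i) i₀))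
    have h2 : q (Sum.inr (i₀ + 1)) = q (Sum.inr (i₀ + 2)) := by
      have h := hwv (i₀ + 1)
      rw [(by decide : ∀ i : Fin 3, i + 1 + 1 = i + 2) i₀] at h
      exact h.trans (hvw _ ((by decide : ∀ i : Fin 3, i + 2 ≠ i) i₀))
    intro i
    rcases fin_three_cases i₀ i with rfl | rfl | rfl
    · rfl
    · exact h1.symm
    · exact (h1.trans h2).symm
  have hq : ∀ u, q u = q (Sum.inr i₀) := by
    rintro (i | i)
    · have := hwv (i - 1)
      rw [sub_add_cancel] at this
      rw [← this, hw]
    · exact hw i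
  refine Nat.card_eq_one_iff_unique.2 ⟨⟨?_⟩, ⟨q (Sum.inr i₀)⟩⟩
  rintro ⟨u⟩ ⟨v⟩
  exact (hq u).trans (hq v).symm

theorem loopOfLoops_isConnected : (loopOfLoops ℓ m hℓ hm).IsConnected :=
  card_components_loopOfLoops ℓ m hℓ hm 0 (fun _ _ => Set.mem_univ _)
    fun _ => ⟨0, Set.mem_univ _⟩

/-- Without a connecting edge two others remain; without a loop edge its parallel edge `j + 1`
remains. -/
theorem loopOfLoops_not_isSeparating (e : (loopOfLoops ℓ m hℓ hm).E) :
    ¬ (loopOfLoops ℓ m hℓ hm).IsSeparating e := by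
  refine not_not.2 ?_
  rcases e with i | ⟨i, j⟩
  · exact card_components_loopOfLoops ℓ m hℓ hm i
      (fun k hk h => hk (Sum.inl_injective h)) fun k => ⟨0, fun h => Sum.inr_ne_inl h⟩
  · refine card_components_loopOfLoops ℓ m hℓ hm 0 (fun k _ h => Sum.inl_ne_inr h)
      fun k => ⟨j + 1, fun h => ?_⟩
    exact (by decide : ∀ j : Fin 2, j + 1 ≠ j) j (congrArg Prod.snd (Sum.inr_injective h))

theorem card_edges_loopOfLoops : Nat.card (loopOfLoops ℓ m hℓ hm).E = 9 := by
  change Nat.card (Fin 3 ⊕ (Fin 3 × Fin 2)) = 9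
  simp

theorem loopOfLoops_isStable : (loopOfLoops ℓ m hℓ hm).toMultigraph.IsStable 4 where
  connected := loopOfLoops_isConnected ℓ m hℓ hm
  genus_eq := by
    have h1 : Nat.card ((loopOfLoops ℓ m hℓ hm).Components Set.univ) = 1 :=
      loopOfLoops_isConnected ℓ m hℓ hm
    have h2 : Nat.card (loopOfLoops ℓ m hℓ hm).V = 6 := by
      change Nat.card (Fin 3 ⊕ Fin 3) = 6
      simp
    rw [Multigraph.genus, Multigraph.betti, h1, h2, Nat.card_congr (Equiv.Set.univ _),
      card_edges_loopOfLoops]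
    norm_num
  three_le_valence := by
    have key : ∀ v : Fin 3 ⊕ Fin 3, 3 ≤ Nat.card {e : Fin 3 ⊕ (Fin 3 × Fin 2) //
          (Sum.elim (fun i => Sum.inl i) (fun k => Sum.inr k.1) e : Fin 3 ⊕ Fin 3) = v} +
        Nat.card {e : Fin 3 ⊕ (Fin 3 × Fin 2) //
          (Sum.elim (fun i => Sum.inr i) (fun k => Sum.inl (k.1 + 1)) e : Fin 3 ⊕ Fin 3) = v} := by
      simp only [Nat.card_eq_fintype_card]
      decide
    exact key

/-- Changing the lengths of a loop of loops gives a loop of loops. -/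
def loopOfLoopsWithLenIso (len : (loopOfLoops ℓ m hℓ hm).E → ℝ) (h : ∀ e, 0 < len e) :
    Iso ((loopOfLoops ℓ m hℓ hm).withLen len h)
      (loopOfLoops (fun i => len (Sum.inl i)) (fun i j => len (Sum.inr (i, j)))
        (fun _ => h _) fun _ _ => h _) where
  vert := Equiv.refl _
  edge := Equiv.refl _
  len_eq := by rintro (i | ⟨i, j⟩) <;> rfl
  ends _ := Or.inl ⟨rfl, rfl⟩

end LoopOfLoops

/-! ### The locus in the moduli space -/

theorem isOpen_loopOfLoopsLocus : IsOpen loopOfLoopsLocus := by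
  apply isOpen_of_maximal
  rintro x ⟨ℓ, m, hℓ, hm, h1, h2, h3, hx⟩
  refine ⟨_, hx, ?_, {len : Fin 3 ⊕ (Fin 3 × Fin 2) → ℝ |
    len (Sum.inl 0) > len (Sum.inl 1) ∧ len (Sum.inl 1) > len (Sum.inl 2) ∧
      len (Sum.inl 1) + len (Sum.inl 2) > len (Sum.inl 0)}, ?_, ⟨h1, h2, h3⟩, ?_⟩
  · rw [card_edges_loopOfLoops]
    norm_num
  · have hc : ∀ k : Fin 3, Continuous fun len : Fin 3 ⊕ (Fin 3 × Fin 2) → ℝ => len (Sum.inl k) :=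
      fun k => continuous_apply _
    exact (isOpen_lt (hc 1) (hc 0)).inter
      ((isOpen_lt (hc 2) (hc 1)).inter (isOpen_lt (hc 0) ((hc 1).add (hc 2))))
  · rintro len ⟨k1, k2, k3⟩ hpos y ⟨p, hp, ⟨i⟩⟩
    exact ⟨_, _, _, _, k1, k2, k3, p, hp, ⟨i.trans (loopOfLoopsWithLenIso ℓ m hℓ hm len hpos)⟩⟩

theorem loopOfLoopsLocus_nonempty : loopOfLoopsLocus.Nonempty := by
  have hℓ : ∀ i, (0 : ℝ) < (![5, 4, 3] : Fin 3 → ℝ) i := by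
    intro i
    fin_cases i <;> norm_num
  have hm : ∀ (i : Fin 3) (j : Fin 2), (0 : ℝ) < (fun _ _ => 1 : Fin 3 → Fin 2 → ℝ) i j :=
    fun _ _ => one_pos
  obtain ⟨x, hx⟩ := exists_represents (loopOfLoops_isStable _ _ hℓ hm)
  exact ⟨x, _, _, hℓ, hm, (by norm_num : (5 : ℝ) > 4), (by norm_num : (4 : ℝ) > 3),
    (by norm_num : (4 : ℝ) + 3 > 5), hx⟩

theorem loopOfLoopsLocus_subset_bridgelessModuli : loopOfLoopsLocus ⊆ bridgelessModuli 4 := by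
  rintro x ⟨ℓ, m, hℓ, hm, -, -, -, hx⟩ Γ hΓ e
  obtain ⟨i⟩ := hx.nonempty_iso hΓ
  obtain ⟨k, rfl⟩ := i.edge.surjective e
  refine not_not.2 (i.card_components_eq_one (I := {k}ᶜ) (fun k' hk' h => ?_)
    (not_not.1 (loopOfLoops_not_isSeparating ℓ m hℓ hm k)))
  exact hk' (i.edge.injective h)

/-! ### Special divisors on loops of loops -/

section

variable {ℓ : Fin 3 → ℝ} {m : Fin 3 → Fin 2 → ℝ} {hℓ : ∀ i, 0 < ℓ i} {hm : ∀ i j, 0 < m i j}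
  {Γ : MetricGraph} (φ : Iso (loopOfLoops ℓ m hℓ hm) Γ)

/-- The divisor with one chip on each of the three connecting edges. -/
def connectingDivisor (x : Fin 3 → ℝ) : Γ.Div :=
  ∑ i, Finsupp.single (φ.point (Sum.inl i) (x i)) 1

theorem point_inl_zero (i : Fin 3) : φ.point (Sum.inl i) 0 = Sum.inl (φ.vert (Sum.inl i)) :=
  φ.point_zero (Sum.inl i)

theorem point_inl_len (i : Fin 3) : φ.point (Sum.inl i) (ℓ i) = Sum.inl (φ.vert (Sum.inr i)) :=
  φ.point_len (Sum.inl i)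

theorem point_inr_zero (i : Fin 3) (j : Fin 2) :
    φ.point (Sum.inr (i, j)) 0 = Sum.inl (φ.vert (Sum.inr i)) :=
  φ.point_zero (Sum.inr (i, j))

theorem point_inr_len (i : Fin 3) (j : Fin 2) :
    φ.point (Sum.inr (i, j)) (m i j) = Sum.inl (φ.vert (Sum.inl (i + 1))) :=
  φ.point_len (Sum.inr (i, j))

theorem connectingDivisor_equiv {x y : Fin 3 → ℝ} (hx : ∀ i, x i ∈ Set.Icc 0 (ℓ i))
    (hy : ∀ i, y i ∈ Set.Icc 0 (ℓ i)) (hxy : ∑ i, y i = ∑ i, x i) :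
    Γ.cls (connectingDivisor φ y) = Γ.cls (connectingDivisor φ x) := by
  apply cls_eq_of_sub_mem
  rw [connectingDivisor, connectingDivisor, ← Finset.sum_sub_distrib]
  let s : Fin 3 → (loopOfLoops ℓ m hℓ hm).Segment := fun i => ⟨Sum.inl i, x i, y i, hx i, hy i⟩
  let d : Fin 3 → ℝ := fun i => y i - x i
  have hd : d 0 + d 1 + d 2 = 0 := by
    rw [Fin.sum_univ_three, Fin.sum_univ_three] at hxy
    simp only [d]
    linarith
  refine φ.sum_segments_mem_prin Finset.univ s
    -- Potentials at the `v i` and the `w i`: rise by `d i` across the `i`-th connecting edge and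
    -- stay constant on loops. Returning to `0` at `w 2` is the condition `hd`.
    (Sum.elim ![0, d 0, d 0 + d 1] ![d 0, d 0 + d 1, 0]) ?_
  have hs : ∀ k, (s k).disp (Sum.inl k) = d k := fun k => ((s k).disp_eq _).trans (if_pos rfl)
  have hs' : ∀ i e, (s i).edge ≠ e → (s i).disp e = 0 :=
    fun i e h => ((s i).disp_eq _).trans (if_neg h)
  rintro (k | ⟨k, j⟩)
  · refine (Finset.sum_eq_single k (fun i _ hi => hs' i _ fun h => hi (Sum.inl_injective h))
      (fun h => (h (Finset.mem_univ k)).elim)).trans ((hs k).trans ?_)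
    change d k = (![d 0, d 0 + d 1, 0] : Fin 3 → ℝ) k - (![0, d 0, d 0 + d 1] : Fin 3 → ℝ) k
    fin_cases k
    · simp
    · simp
    · simp only [Fin.reduceFinMk, Matrix.cons_val]
      linarith
  · refine (Finset.sum_eq_zero fun i _ => hs' i _ Sum.inl_ne_inr).trans ?_
    change 0 = (![0, d 0, d 0 + d 1] : Fin 3 → ℝ) (k + 1) - (![d 0, d 0 + d 1, 0] : Fin 3 → ℝ) k
    fin_cases k <;> simp

/-- Chips at the two ends of an edge of a loop can be moved towards each other. -/
theorem ends_equiv (i : Fin 3) (j : Fin 2) {t : ℝ} (ht : t ∈ Set.Icc 0 (m i j)) :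
    Γ.cls (Finsupp.single (φ.point (Sum.inr (i, j)) t) 1 +
      Finsupp.single (φ.point (Sum.inr (i, j)) (m i j - t)) 1) =
    Γ.cls (Finsupp.single (Sum.inl (φ.vert (Sum.inr i))) 1 +
      Finsupp.single (Sum.inl (φ.vert (Sum.inl (i + 1)))) 1) := by
  apply cls_eq_of_sub_mem
  rw [← point_inr_zero φ i j, ← point_inr_len φ i j, add_sub_add_comm]
  have hm0 := (hm i j).le
  let s : Fin 2 → (loopOfLoops ℓ m hℓ hm).Segment :=
    ![⟨Sum.inr (i, j), 0, t, ⟨le_rfl, hm0⟩, ht⟩,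
      ⟨Sum.inr (i, j), m i j, m i j - t, ⟨hm0, le_rfl⟩, sub_nonneg.2 ht.2,
        sub_le_self _ ht.1⟩]
  -- The displacements `t` and `-t` cancel on the single edge involved, so the zero potential works.
  have := φ.sum_segments_mem_prin Finset.univ s 0 (by
    intro k
    have h : (s 1).edge = (s 0).edge := rfl
    rw [Fin.sum_univ_two, Segment.disp_eq, Segment.disp_eq, h]
    split_ifs
    · change t - 0 + (m i j - t - m i j) = 0 - 0
      ring
    · simp)
  rw [Fin.sum_univ_two] at this
  exact this

theorem one_le_rank_connectingDivisor {x : Fin 3 → ℝ} (hx : ∀ i, x i ∈ Set.Icc 0 (ℓ i))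
    (hlo : ∀ i, ℓ i ≤ ∑ j, x j) (hhi : ∀ i, ∑ j, x j ≤ ℓ (i + 1) + ℓ (i + 2)) :
    ((1 : ℕ) : WithBot ℕ∞) ≤ rank (connectingDivisor φ x) := by
  apply one_le_rank
  intro p
  obtain ⟨k, t, ht, rfl⟩ := φ.exists_eq_point (by
    rintro (i | i)
    · exact ⟨Sum.inl i, Or.inl rfl⟩
    · exact ⟨Sum.inl i, Or.inr rfl⟩) p
  set c := ∑ j, x j
  rcases k with i | ⟨i, j⟩
  · replace ht : t ∈ Set.Icc 0 (ℓ i) := ht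
    -- Fix one chip at the given point and distribute `c - t` greedily: fill the next edge as far as
    -- possible, and put the remainder on the last one. The bounds on `c` give `0 ≤ c - t ≤ ℓ (i +
    -- 1) + ℓ (i + 2)`.
    obtain ⟨y, h0, h1, h2⟩ := exists_fin_three_cyclic i t (min (c - t) (ℓ (i + 1)))
      (c - t - min (c - t) (ℓ (i + 1)))
    refine ⟨_, (isEffective_single (φ.point (Sum.inl (i + 1)) (y (i + 1)))).add
      (isEffective_single (φ.point (Sum.inl (i + 2)) (y (i + 2)))), ?_⟩
    rw [← connectingDivisor_equiv φ hx (y := y) ?_ ?_, connectingDivisor,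
      sum_fin_three_cyclic _ i, h0]
    · have hct : 0 ≤ c - t := by linarith [hlo i, ht.2]
      refine forall_fin_three_cyclic i ?_ ?_ ?_
      · rwa [h0]
      · rw [h1]
        exact ⟨le_min hct (hℓ _).le, min_le_right _ _⟩
      · rw [h2]
        refine ⟨sub_nonneg.2 (min_le_left _ _), ?_⟩
        rcases min_choice (c - t) (ℓ (i + 1)) with h | h <;> rw [h]
        · linarith [hℓ (i + 2)]
        · linarith [hhi i, ht.1]
    · rw [sum_fin_three_cyclic y i, h0, h1, h2]
      ring
  · replace ht : t ∈ Set.Icc 0 (m i j) := ht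
    -- These coordinates put chips at `w i` and `v (i + 1)`, the two ends of the loop. The third
    -- chip fits because `ℓ i ≤ c ≤ ℓ (i + 2) + ℓ i`, the upper bound being `hhi` at `i + 1`.
    obtain ⟨y, h0, h1, h2⟩ := exists_fin_three_cyclic i (ℓ i) 0 (c - ℓ i)
    refine ⟨_, (isEffective_single (φ.point (Sum.inr (i, j)) (m i j - t))).add
      (isEffective_single (φ.point (Sum.inl (i + 2)) (y (i + 2)))), ?_⟩
    rw [← connectingDivisor_equiv φ hx (y := y) ?_ ?_, connectingDivisor,
      sum_fin_three_cyclic _ i, h0, h1, point_inl_len, point_inl_zero, ← add_assoc, ← add_assoc]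
    · exact congrArg (· + Γ.cls (Finsupp.single (φ.point (Sum.inl (i + 2)) (y (i + 2))) 1))
        (ends_equiv φ i j ht)
    · refine forall_fin_three_cyclic i ?_ ?_ ?_
      · rw [h0]
        exact ⟨(hℓ i).le, le_rfl⟩
      · rw [h1]
        exact ⟨le_rfl, (hℓ _).le⟩
      · rw [h2]
        have h := hhi (i + 1)
        rw [(by decide : ∀ i : Fin 3, i + 1 + 1 = i + 2) i,
          (by decide : ∀ i : Fin 3, i + 1 + 2 = i) i] at h
        exact ⟨by linarith [hlo i], by linarith⟩
    · rw [sum_fin_three_cyclic y i, h0, h1, h2]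
      ring

theorem exists_harmonic_loopOfLoops :
    ∃ ω : Γ.E → ℝ, ω ∈ Γ.Harmonic ∧ ω (φ.edge (Sum.inl 0)) ≠ 0 := by
  classical
  -- Unit flow around the big cycle, split equally between the two edges of each loop.
  let ω : (loopOfLoops ℓ m hℓ hm).E → ℝ := Sum.elim (fun _ => 1) (fun _ => 1 / 2)
  have hω : ω ∈ (loopOfLoops ℓ m hℓ hm).Harmonic := by
    have key : ∀ v : Fin 3 ⊕ Fin 3, ∑ e : Fin 3 ⊕ (Fin 3 × Fin 2),
        ((if Sum.elim (fun i => Sum.inr i) (fun k => Sum.inl (k.1 + 1)) e = v then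
            (Sum.elim (fun _ => 1) (fun _ => 1 / 2) e : ℝ) else 0) -
          (if Sum.elim (fun i => Sum.inl i) (fun k => Sum.inr k.1) e = v then
            (Sum.elim (fun _ => 1) (fun _ => 1 / 2) e : ℝ) else 0)) = 0 := by
      rintro (i | i) <;> fin_cases i <;>
        simp [Fintype.sum_sum_type, Fintype.sum_prod_type, Fin.sum_univ_three] <;> norm_num
    intro v
    refine (Finset.sum_congr rfl fun e _ => ?_).trans (key v)
    -- `Harmonic` uses classical decidability, `key` the instances on explicit finite types.
    have hite : ∀ (P : Prop) (d d' : Decidable P) (x : ℝ), @ite ℝ P d x 0 = @ite ℝ P d' x 0 :=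
      fun P d d' x => by congr
    exact congrArg₂ (· - ·) (hite _ _ _ _) (hite _ _ _ _)
  refine ⟨_, φ.mem_harmonic hω, ?_⟩
  exact (congrArg (fun k => φ.sign k * ω k) (φ.edge.symm_apply_apply (Sum.inl 0))).trans_ne
    (mul_ne_zero (φ.sign_ne_zero _) one_ne_zero)

theorem polyDim_brillNoetherLocus_pos (φ : Iso (loopOfLoops ℓ m hℓ hm) Γ)
    (h1 : ℓ 0 > ℓ 1) (h2 : ℓ 1 > ℓ 2)
    (h3 : ℓ 1 + ℓ 2 > ℓ 0) (w : Γ.Point) : 0 < Γ.polyDim w 3 (Γ.brillNoetherLocus 1 3) := by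
  classical
  obtain ⟨ω, hω, hω0⟩ := exists_harmonic_loopOfLoops φ
  -- With the other chips at `w 1` and `v 2`, the sum is `c = s + ℓ 1`; this range of `s` is exactly
  -- `ℓ 0 ≤ c ≤ ℓ 1 + ℓ 2`.
  have hsub : Set.Icc (ℓ 0 - ℓ 1) (ℓ 2) ⊆ Set.Icc 0 (ℓ 0) :=
    Set.Icc_subset_Icc (by linarith) (by linarith)
  obtain ⟨a, b, hab, h⟩ := φ.exists_param_Icc (Sum.inl 0)
    (show ℓ 0 - ℓ 1 < ℓ 2 by linarith)
  refine polyDim_pos (φ.isConnected (loopOfLoops_isConnected ℓ m hℓ hm)) w hω hω0 hab ?_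
    (Finsupp.single (φ.point (Sum.inl 1) (ℓ 1)) 1 + Finsupp.single (φ.point (Sum.inl 2) 0) 1)
    ?_ ?_
  · intro t ht
    obtain ⟨s, hs, rfl⟩ := h t ht
    exact φ.param_mem (Sum.inl 0) (hsub hs)
  · intro t _
    simp only [deg_add, deg_single]
    norm_num
  · intro t ht
    obtain ⟨s, hs, rfl⟩ := h t ht
    refine ⟨_, rfl, by simp only [deg_add, deg_single]; norm_num, ?_⟩
    have hD : Finsupp.single (Γ.pt (φ.edge (Sum.inl 0)) (φ.param (Sum.inl 0) s)) 1 +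
        (Finsupp.single (φ.point (Sum.inl 1) (ℓ 1)) 1 + Finsupp.single (φ.point (Sum.inl 2) 0) 1) =
        connectingDivisor φ ![s, ℓ 1, 0] := by
      rw [connectingDivisor, Fin.sum_univ_three, ← add_assoc]
      rfl
    rw [hD]
    apply one_le_rank_connectingDivisor
    · exact forall_fin_three_cyclic 0 (hsub hs) ⟨(hℓ 1).le, le_rfl⟩ ⟨le_rfl, (hℓ 2).le⟩
    all_goals
      have hsum : ∑ j, (![s, ℓ 1, 0] : Fin 3 → ℝ) j = s + ℓ 1 := by
        simp [Fin.sum_univ_three]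
      rw [hsum]
      obtain ⟨hs1, hs2⟩ := hs
      refine forall_fin_three_cyclic 0 ?_ ?_ ?_
    · linarith
    · change ℓ 1 ≤ _
      linarith
    · change ℓ 2 ≤ _
      linarith
    · change _ ≤ ℓ 1 + ℓ 2
      linarith
    · change _ ≤ ℓ 2 + ℓ 0
      linarith
    · change _ ≤ ℓ 0 + ℓ 1
      linarith

end

end

end TropicalBN

theorem mainTheorem3 :
    IsOpen TropicalBN.loopOfLoopsLocus ∧
    IsOpen ((↑) ⁻¹' TropicalBN.loopOfLoopsLocus : Set (TropicalBN.bridgelessModuli 4)) ∧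
    TropicalBN.loopOfLoopsLocus.Nonempty ∧
    TropicalBN.loopOfLoopsLocus ⊆ TropicalBN.bridgelessModuli 4 ∧
    TropicalBN.brillNoetherNumber 4 1 3 = 0 ∧
    ∀ x ∈ TropicalBN.loopOfLoopsLocus, ∀ Γ : TropicalBN.MetricGraph, Γ.Represents x →
      ∀ w : Γ.Point, 0 < Γ.polyDim w 3 (Γ.brillNoetherLocus 1 3) := by
  refine ⟨TropicalBN.isOpen_loopOfLoopsLocus,
    TropicalBN.isOpen_loopOfLoopsLocus.preimage continuous_subtype_val,
    TropicalBN.loopOfLoopsLocus_nonempty, TropicalBN.loopOfLoopsLocus_subset_bridgelessModuli,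
    by norm_num [TropicalBN.brillNoetherNumber], ?_⟩
  rintro x ⟨ℓ, m, hℓ, hm, h1, h2, h3, hx⟩ Γ hΓ w
  obtain ⟨φ⟩ := hx.nonempty_iso hΓ
  exact TropicalBN.polyDim_brillNoetherLocus_pos φ h1 h2 h3 w
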